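/- Let $\mathcal C$ be a skeletally small additive category with split idempotents which is Krull–Schmidt (every object is a finite direct sum of objects with local endomorphism ring). Let $\mathcal B$ be a full additive subcategory of $\mathcal C$ with $\mathcal B=\mathrm{add}(\mathcal B)$, i.e. closed under direct summands of finite direct sums. Let $I_{\mathcal B}$ be the ideal of morphisms of $\mathcal C$ that factor through an object of $\mathcal B$, let $\mathcal C/I_{\mathcal B}$ be the quotient category, and write $\mathrm{Mod}(-)$ for the category of additive functors to abelian groups. Let $$\mathcal C/I_{\mathcal B}\otimes_{\mathcal C}-\;:\;\mathrm{Mod}(\mathcal C)\to\mathrm{Mod}(\mathcal C/I_{\mathcal B}),\qquad (\mathcal C/I_{\mathcal B}\otimes_{\mathcal C}M)(C)=\frac{\mathcal C(-,C)}{I_{\mathcal B}(-,C)}\otimes_{\mathcal C}M,$$ which is the left adjoint of restriction along $\mathcal C\to\mathcal C/I_{\mathcal B}$ in the canonical recollement of $\mathrm{Mod}(\mathcal C)$ by $\mathrm{Mod}(\mathcal C/I_{\mathcal B})$ and $\mathrm{Mod}(\mathcal B)$. Suppose that the functor $\mathcal C/I_{\mathcal B}\otimes_{\mathcal C}-$ is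 exact and that $\mathcal B$ is contravariantly finite in $\mathcal C$ (for every $A\in\mathcal C$ there is a morphism $B\to A$ with $B\in\mathcal B$ through which every morphism $B'\to A$ with $B'\in\mathcal B$ factors). Let $\mathcal B^{\perp_0}=\{X\in\mathcal C\mid \mathcal C(B,X)=0\ \text{for all } B\in\mathcal B\}$. Then: 1. $(\mathcal B,\mathcal B^{\perp_0})$ is a splitting torsion pair in $\mathcal C$: both are full additive subcategories, every indecomposable object of $\mathcal C$ lies in $\mathcal B$ or in $\mathcal B^{\perp_0}$, and $\mathcal C(B,X)=0$ for all $B\in\mathcal B$, $X\in\mathcal B^{\perp_0}$. 2. There is an additive equivalence of categories $$\mathcal C\simeq\begin{bmatrix}\mathcal B^{\perp_0}&0\\ \overline{\mathrm{Hom}}&\mathcal B\end{bmatrix}.$$ Here $\overline{\mathrm{Hom}}(U,T)=\mathcal C(T,U)$ for $U\in\mathcal B$, $T\in\mathcal B^{\perp_0}$, and the triangular matrix category on the right has as objects the pairs $(T,U)$ with $T\in\mathcal B^{\perp_0}$, $U\in\mathcal B$, as morphisms $(T,U)\to(T',U')$ the matrices $\begin{bmatrix}t&0\\ m&u\end{bmatrix}$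 with $t\in\mathcal C(T,T')$, $m\in\mathcal C(T,U')$, $u\in\mathcal C(U,U')$, added entrywise, and composition given by the matrix product $$\begin{bmatrix}t_2&0\\ m_2&u_2\end{bmatrix}\begin{bmatrix}t_1&0\\ m_1&u_1\end{bmatrix}=\begin{bmatrix}t_2t_1&0\\ m_2t_1+u_2m_1&u_2u_1\end{bmatrix}.$$ -/

import Mathlib

open CategoryTheory CategoryTheory.Limits Opposite

universe u u₁ u₂ v

namespace TriangularRecollement

noncomputable section

attribute [local instance] hasBinaryBiproducts_of_finite_biproducts

/-! ### Krull-Schmidt categories and additive subcategories -/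

section Subcategories

variable {C : Type u} [Category.{v} C] [Preadditive C] [HasFiniteBiproducts C]

variable (C) in
/-- An additive category is Krull-Schmidt if every object is a finite direct sum of objects with
local endomorphism ring. -/
def IsKrullSchmidt : Prop :=
  ∀ X : C, ∃ (n : ℕ) (F : Fin n → C),
    (∀ i, IsLocalRing (End (F i))) ∧ Nonempty (X ≅ ⨁ F)

/-- A full subcategory (given by a property of objects) is additive if it contains the zero
objects and is closed under direct sums (both up to isomorphism). -/
class IsAdditiveSubcategory (P : ObjectProperty C) : Prop where
  of_isZero : ∀ X : C, IsZero X → P X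
  biprod : ∀ X Y : C, P X → P Y → P (X ⊞ Y)
  of_iso : ∀ X Y : C, (X ≅ Y) → P X → P Y

/-- `add(B)`: the direct summands of finite direct sums of objects of `B`. -/
def addClosure (P : ObjectProperty C) : ObjectProperty C :=
  fun X => ∃ (n : ℕ) (F : Fin n → C) (Y : C), (∀ i, P (F i)) ∧ Nonempty (X ⊞ Y ≅ ⨁ F)

/-- A splitting torsion pair `(U, T)` of full additive subcategories of a (Krull-Schmidt)
category: every indecomposable object lies in `U` or in `T`, and `Hom(U, T) = 0`. -/
structure IsSplittingTorsionPair (U T : ObjectProperty C) : Prop where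
  additive_left : IsAdditiveSubcategory U
  additive_right : IsAdditiveSubcategory T
  mem_or_mem : ∀ X : C, Indecomposable X → U X ∨ T X
  hom_eq_zero : ∀ (X Y : C) (f : X ⟶ Y), U X → T Y → f = 0

end Subcategories

/-- `B` is contravariantly finite: every object has a right `B`-approximation. -/
def IsContravariantlyFinite {C : Type u} [Category.{v} C] (P : ObjectProperty C) : Prop :=
  ∀ A : C, ∃ (B : C) (f : B ⟶ A), P B ∧
    ∀ (B' : C) (f' : B' ⟶ A), P B' → ∃ g : B' ⟶ B, g ≫ f = f'

/-! ### The ideal of morphisms factoring through a subcategory, and its quotient category -/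

/-- The morphism `f` factors through an object of `B`. -/
def FactorsThrough {C : Type u} [Category.{v} C] (P : ObjectProperty C) {X Y : C}
    (f : X ⟶ Y) : Prop :=
  ∃ (B : C) (a : X ⟶ B) (b : B ⟶ Y), P B ∧ a ≫ b = f

/-- Congruence modulo the ideal `I_B` of the morphisms factoring through `B`. -/
def idealRel {C : Type u} [Category.{v} C] [Preadditive C] (P : ObjectProperty C) : HomRel C :=
  fun _ _ f g => FactorsThrough P (f - g)

theorem FactorsThrough.neg {C : Type u} [Category.{v} C] [Preadditive C] {P : ObjectProperty C}
    {X Y : C} {f : X ⟶ Y} (h : FactorsThrough P f) : FactorsThrough P (-f) := by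
  obtain ⟨B, a, b, hB, rfl⟩ := h
  exact ⟨B, -a, b, hB, by simp⟩

section Ideal

variable {C : Type u} [Category.{v} C] [Preadditive C] [HasFiniteBiproducts C]
  {P : ObjectProperty C} [IsAdditiveSubcategory P] {X Y : C}

theorem FactorsThrough.zero : FactorsThrough P (0 : X ⟶ Y) :=
  ⟨⨁ (Fin.elim0 : Fin 0 → C), 0, 0, IsAdditiveSubcategory.of_isZero _
    ((IsZero.iff_id_eq_zero _).2 (by ext i; exact i.elim0)), by simp⟩

theorem FactorsThrough.add {f g : X ⟶ Y} (hf : FactorsThrough P f) (hg : FactorsThrough P g) :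
    FactorsThrough P (f + g) := by
  obtain ⟨B, a, b, hB, rfl⟩ := hf
  obtain ⟨B', a', b', hB', rfl⟩ := hg
  exact ⟨B ⊞ B', biprod.lift a a', biprod.desc b b',
    IsAdditiveSubcategory.biprod _ _ hB hB', by simp⟩

instance idealRel_congruence : Congruence (idealRel P) where
  equivalence :=
    { refl := fun f => by simpa [idealRel] using FactorsThrough.zero
      symm := fun {f g} h => by simpa [idealRel] using FactorsThrough.neg h
      trans := fun {f g k} h h' => by
        simpa [idealRel] using FactorsThrough.add (P := P) h h' }
  comp_left {_ _ _} f {g g'} h := by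
    obtain ⟨B, a, b, hB, h⟩ := h
    exact ⟨B, f ≫ a, b, hB, by simp [h]⟩
  comp_right {_ _ _ f f'} g h := by
    obtain ⟨B, a, b, hB, h⟩ := h
    exact ⟨B, a, b ≫ g, hB, by simp [reassoc_of% h]⟩

theorem idealRel_add ⦃X Y : C⦄ (f₁ f₂ g₁ g₂ : X ⟶ Y) (hf : idealRel P f₁ f₂)
    (hg : idealRel P g₁ g₂) : idealRel P (f₁ + g₁) (f₂ + g₂) := by
  have := FactorsThrough.add (P := P) hf hg
  rwa [sub_add_sub_comm] at this

variable (P)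

/-- The quotient category `C/I_B`, with `(C/I_B)(X, Y) = C(X, Y)/I_B(X, Y)`. -/
abbrev IdealQuotient := Quotient (idealRel P)

instance : Preadditive (IdealQuotient P) := Quotient.preadditive (idealRel P) idealRel_add

/-- The canonical projection functor `C ⥤ C/I_B`. -/
abbrev idealQuotientFunctor : C ⥤ IdealQuotient P := Quotient.functor (idealRel P)

instance : (idealQuotientFunctor P).Additive := Quotient.functor_additive _ idealRel_add

end Ideal

/-! ### Modules over a category, tensor products, exactness -/

/-- `Mod(C)`: the category of additive functors from `C` to abelian groups. -/
abbrev ModCat (C : Type u) [Category.{v} C] [Preadditive C] := C ⥤+ AddCommGrpCat.{v}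

/-- Exactness of `M₁ ⟶ M₂ ⟶ M₃` in `Mod(C)`. Kernels and images in `Mod(C)` are computed objectwise,
so that this is exactness at every object. -/
def ModExact {C : Type u} [Category.{v} C] [Preadditive C] {M₁ M₂ M₃ : ModCat C}
    (f : M₁ ⟶ M₂) (g : M₂ ⟶ M₃) : Prop :=
  ∀ X : C, Function.Exact (f.hom.app X) (g.hom.app X)

/-- A functor between module categories is exact if it takes exact sequences to exact
sequences. -/
def IsExactFunctor {C : Type u₁} [Category.{v} C] [Preadditive C] {D : Type u₂} [Category.{v} D]
    [Preadditive D] (F : ModCat C ⥤ ModCat D) : Prop :=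
  ∀ ⦃M₁ M₂ M₃ : ModCat C⦄ (f : M₁ ⟶ M₂) (g : M₂ ⟶ M₃), ModExact f g → ModExact (F.map f) (F.map g)

section Tensor

variable {C : Type u} [Category.{v} C] [EssentiallySmall.{v} C]

variable (C) in
/-- The embedding of a small category equivalent to `C`, over which tensor products are formed. -/
abbrev smallEmb : SmallModel.{v} C ⥤ C := (equivSmallModel.{v} C).inverse

/-- The generators `x ⊗ y` of `N ⊗_C M`, with `x ∈ N(c)` and `y ∈ M(c)`. -/
abbrev TensorGen (N : Cᵒᵖ ⥤ AddCommGrpCat.{v}) (M : C ⥤ AddCommGrpCat.{v}) : Type v :=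
  Σ c : SmallModel.{v} C, N.obj (op ((smallEmb C).obj c)) × M.obj ((smallEmb C).obj c)

/-- The generator `x ⊗ y` in the free abelian group on the generators. -/
abbrev tensorPure (N : Cᵒᵖ ⥤ AddCommGrpCat.{v}) (M : C ⥤ AddCommGrpCat.{v}) (c : SmallModel.{v} C)
    (x : N.obj (op ((smallEmb C).obj c))) (y : M.obj ((smallEmb C).obj c)) :
    FreeAbelianGroup (TensorGen N M) :=
  FreeAbelianGroup.of ⟨c, x, y⟩

/-- The defining relations of `N ⊗_C M`: biadditivity, and `(x · a) ⊗ y = x ⊗ (a · y)` for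
morphisms `a`. -/
inductive TensorRel (N : Cᵒᵖ ⥤ AddCommGrpCat.{v}) (M : C ⥤ AddCommGrpCat.{v}) :
    FreeAbelianGroup (TensorGen N M) → Prop
  | add_left (c : SmallModel.{v} C) (x x' : N.obj (op ((smallEmb C).obj c)))
      (y : M.obj ((smallEmb C).obj c)) :
      TensorRel N M (tensorPure N M c (x + x') y - (tensorPure N M c x y + tensorPure N M c x' y))
  | add_right (c : SmallModel.{v} C) (x : N.obj (op ((smallEmb C).obj c)))
      (y y' : M.obj ((smallEmb C).obj c)) :
      TensorRel N M (tensorPure N M c x (y + y') - (tensorPure N M c x y + tensorPure N M c x y'))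
  | balanced {c d : SmallModel.{v} C} (a : c ⟶ d) (x : N.obj (op ((smallEmb C).obj d)))
      (y : M.obj ((smallEmb C).obj c)) :
      TensorRel N M (tensorPure N M c (N.map ((smallEmb C).map a).op x) y -
        tensorPure N M d x (M.map ((smallEmb C).map a) y))

/-- The subgroup of relations of `N ⊗_C M`. -/
def tensorRelations (N : Cᵒᵖ ⥤ AddCommGrpCat.{v}) (M : C ⥤ AddCommGrpCat.{v}) :
    AddSubgroup (FreeAbelianGroup (TensorGen N M)) :=
  AddSubgroup.closure {z | TensorRel N M z}

/-- The tensor product `N ⊗_C M` of a right and a left `C`-module. -/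
abbrev Tensor (N : Cᵒᵖ ⥤ AddCommGrpCat.{v}) (M : C ⥤ AddCommGrpCat.{v}) : Type v :=
  FreeAbelianGroup (TensorGen N M) ⧸ tensorRelations N M

/-- The map of free abelian groups `x ⊗ y ↦ α(x) ⊗ β(y)`. -/
def tensorGenMap {N N' : Cᵒᵖ ⥤ AddCommGrpCat.{v}} {M M' : C ⥤ AddCommGrpCat.{v}}
    (α : N ⟶ N') (β : M ⟶ M') :
    FreeAbelianGroup (TensorGen N M) →+ FreeAbelianGroup (TensorGen N' M') :=
  FreeAbelianGroup.map fun z => ⟨z.1, α.app _ z.2.1, β.app _ z.2.2⟩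

theorem tensorGenMap_le {N N' : Cᵒᵖ ⥤ AddCommGrpCat.{v}} {M M' : C ⥤ AddCommGrpCat.{v}}
    (α : N ⟶ N') (β : M ⟶ M') :
    tensorRelations N M ≤ (tensorRelations N' M').comap (tensorGenMap α β) := by
  refine (AddSubgroup.closure_le _).2 ?_
  rintro _ (⟨c, x, x', y⟩ | ⟨c, x, y, y'⟩ | ⟨a, x, y⟩) <;>
    refine AddSubgroup.subset_closure ?_
  · simpa [tensorGenMap] using TensorRel.add_left c (α.app _ x) (α.app _ x') (β.app _ y)
  · simpa [tensorGenMap] using TensorRel.add_right c (α.app _ x) (β.app _ y) (β.app _ y')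
  · simpa [tensorGenMap, NatTrans.naturality_apply] using
      TensorRel.balanced a (α.app _ x) (β.app _ y)

/-- The map `α ⊗ β : N ⊗_C M ⟶ N' ⊗_C M'`. -/
def tensorMap {N N' : Cᵒᵖ ⥤ AddCommGrpCat.{v}} {M M' : C ⥤ AddCommGrpCat.{v}}
    (α : N ⟶ N') (β : M ⟶ M') : Tensor N M →+ Tensor N' M' :=
  QuotientAddGroup.map _ _ (tensorGenMap α β) (tensorGenMap_le α β)

/-- The class of `x ⊗ y` in `N ⊗_C M`. -/
def tmul (N : Cᵒᵖ ⥤ AddCommGrpCat.{v}) (M : C ⥤ AddCommGrpCat.{v}) (c : SmallModel.{v} C)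
    (x : N.obj (op ((smallEmb C).obj c))) (y : M.obj ((smallEmb C).obj c)) : Tensor N M :=
  QuotientAddGroup.mk (tensorPure N M c x y)

theorem tensor_hom_ext {N : Cᵒᵖ ⥤ AddCommGrpCat.{v}} {M : C ⥤ AddCommGrpCat.{v}} {A : Type*}
    [AddCommGroup A] {f g : Tensor N M →+ A}
    (h : ∀ c x y, f (tmul N M c x y) = g (tmul N M c x y)) : f = g := by
  refine QuotientAddGroup.addMonoidHom_ext _ ?_
  ext ⟨c, x, y⟩
  exact h c x y

theorem tensorMap_tmul {N N' : Cᵒᵖ ⥤ AddCommGrpCat.{v}} {M M' : C ⥤ AddCommGrpCat.{v}}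
    (α : N ⟶ N') (β : M ⟶ M') (c x y) :
    tensorMap α β (tmul N M c x y) = tmul N' M' c (α.app _ x) (β.app _ y) := rfl

theorem tmul_add_left {N : Cᵒᵖ ⥤ AddCommGrpCat.{v}} {M : C ⥤ AddCommGrpCat.{v}} (c x x' y) :
    tmul N M c (x + x') y = tmul N M c x y + tmul N M c x' y := by
  have := (QuotientAddGroup.eq_zero_iff _).2
    (AddSubgroup.subset_closure (TensorRel.add_left (N := N) (M := M) c x x' y))
  exact sub_eq_zero.1 this

theorem tmul_add_right {N : Cᵒᵖ ⥤ AddCommGrpCat.{v}} {M : C ⥤ AddCommGrpCat.{v}} (c x y y') :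
    tmul N M c x (y + y') = tmul N M c x y + tmul N M c x y' := by
  have := (QuotientAddGroup.eq_zero_iff _).2
    (AddSubgroup.subset_closure (TensorRel.add_right (N := N) (M := M) c x y y'))
  exact sub_eq_zero.1 this

end Tensor

/-! ### The functor `C/I_B ⊗_C - : Mod(C) ⥤ Mod(C/I_B)` -/

section QuotientTensor

variable {C : Type u} [Category.{v} C] [EssentiallySmall.{v} C] [Preadditive C]
  [HasFiniteBiproducts C] (P : ObjectProperty C) [IsAdditiveSubcategory P]

/-- `D ↦ (C/I_B)(-, D)`, as a functor from `C/I_B` to right `C`-modules. -/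
def quotientBimodule : IdealQuotient P ⥤ Cᵒᵖ ⥤ AddCommGrpCat.{v} :=
  preadditiveYoneda ⋙ (Functor.whiskeringLeft _ _ _).obj (idealQuotientFunctor P).op

/-- The `C/I_B`-module `D ↦ (C/I_B)(-, D) ⊗_C M`. -/
def quotientTensorObj (M : ModCat C) : ModCat (IdealQuotient P) where
  obj :=
    { obj := fun D => AddCommGrpCat.of (Tensor ((quotientBimodule P).obj D) M.obj)
      map := fun f => AddCommGrpCat.ofHom (tensorMap ((quotientBimodule P).map f) (𝟙 M.obj))
      map_id := fun D => by
        ext : 1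
        refine tensor_hom_ext fun c x y => ?_
        simp [tensorMap_tmul]
      map_comp := fun f g => by
        ext : 1
        refine tensor_hom_ext fun c x y => ?_
        simp [tensorMap_tmul] }
  property :=
    { map_add := fun {D E f g} => by
        ext : 1
        refine tensor_hom_ext fun c x y => ?_
        refine Eq.trans ?_ (tmul_add_left (N := (quotientBimodule P).obj E) c _ _ y)
        exact congrArg (fun z => tmul ((quotientBimodule P).obj E) M.obj c z y)
          (Preadditive.comp_add _ _ _ x f g) }

/-- The functor `C/I_B ⊗_C -`, sending a `C`-module `M` to `D ↦ (C/I_B)(-, D) ⊗_C M`. -/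
def quotientTensor : ModCat C ⥤ ModCat (IdealQuotient P) where
  obj M := quotientTensorObj P M
  map {M M'} β := ObjectProperty.homMk
    { app := fun D => AddCommGrpCat.ofHom (tensorMap (𝟙 ((quotientBimodule P).obj D)) β.hom)
      naturality := fun D E f => by
        ext : 1
        refine tensor_hom_ext fun c x y => ?_
        rfl }
  map_id M := by
    ext D : 4
    refine tensor_hom_ext fun c x y => ?_
    rfl
  map_comp f g := by
    ext D : 4
    refine tensor_hom_ext fun c x y => ?_
    rfl

end QuotientTensor

/-! ### Triangular matrix categories -/

section TriangularMatrix

variable {T : Type u₁} [Category.{v} T] [Preadditive T] {U : Type u₂} [Category.{v} U]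
  [Preadditive U]

/-- A `U`-`T`-bimodule: a functor `M(U, T)` with values in abelian groups, covariant in `U`,
contravariant in `T`, and additive in each variable, that is, an additive functor on
`U ⊗ Tᵒᵖ`. -/
abbrev Bimodule (U : Type u₂) [Category.{v} U] [Preadditive U] (T : Type u₁) [Category.{v} T]
    [Preadditive T] := U ⥤+ (Tᵒᵖ ⥤+ AddCommGrpCat.{v})

/-- The abelian group `M(U, T)`. -/
abbrev Bimodule.at (M : Bimodule U T) (X : U) (Y : T) : Type v := (M.obj.obj X).obj.obj (op Y)

/-- `u • m = M(u, 1)(m)`. -/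
def Bimodule.lact (M : Bimodule U T) {X X' : U} (u : X ⟶ X') {Y : T} (m : M.at X Y) :
    M.at X' Y := (M.obj.map u).hom.app (op Y) m

/-- `m • t = M(1, t)(m)`. -/
def Bimodule.ract (M : Bimodule U T) {X : U} {Y Y' : T} (m : M.at X Y') (t : Y ⟶ Y') :
    M.at X Y := (M.obj.obj X).obj.map t.op m

/-- The objects of the triangular matrix category `[[T, 0], [M, U]]`. -/
structure TriMat (M : Bimodule U T) where
  /-- the object of `T` -/
  fst : T
  /-- the object of `U` -/
  snd : U

/-- Morphisms `[[t, 0], [m, u]]` of the triangular matrix category. -/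
@[ext]
structure TriMat.Hom {M : Bimodule U T} (X Y : TriMat M) where
  /-- the entry in `T(X.fst, Y.fst)` -/
  t : X.fst ⟶ Y.fst
  /-- the entry in `M(Y.snd, X.fst)` -/
  m : M.at Y.snd X.fst
  /-- the entry in `U(X.snd, Y.snd)` -/
  u : X.snd ⟶ Y.snd

namespace TriMat

variable {M : Bimodule U T}

/-- The triangular matrix category `[[T, 0], [M, U]]`, whose composition is the matrix product
`[[t₂, 0], [m₂, u₂]] ∘ [[t₁, 0], [m₁, u₁]] = [[t₂ t₁, 0], [m₂ • t₁ + u₂ • m₁, u₂ u₁]]`. -/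
instance : Category (TriMat M) where
  Hom := Hom
  id X := ⟨𝟙 _, 0, 𝟙 _⟩
  comp f g := ⟨f.t ≫ g.t, M.ract g.m f.t + M.lact g.u f.m, f.u ≫ g.u⟩
  id_comp f := by ext <;> simp [Bimodule.ract, Bimodule.lact]
  comp_id f := by ext <;> simp [Bimodule.ract, Bimodule.lact]
  assoc f g h := by
    ext
    · simp
    · simp [Bimodule.ract, Bimodule.lact, add_assoc, NatTrans.naturality_apply]
    · simp

@[simp] theorem id_t (X : TriMat M) : Hom.t (𝟙 X) = 𝟙 _ := rfl
@[simp] theorem id_m (X : TriMat M) : Hom.m (𝟙 X) = 0 := rfl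
@[simp] theorem id_u (X : TriMat M) : Hom.u (𝟙 X) = 𝟙 _ := rfl
@[simp] theorem comp_t {X Y Z : TriMat M} (f : X ⟶ Y) (g : Y ⟶ Z) :
    Hom.t (f ≫ g) = Hom.t f ≫ Hom.t g := rfl
@[simp] theorem comp_m {X Y Z : TriMat M} (f : X ⟶ Y) (g : Y ⟶ Z) :
    Hom.m (f ≫ g) = M.ract (Hom.m g) (Hom.t f) + M.lact (Hom.u g) (Hom.m f) := rfl
@[simp] theorem comp_u {X Y Z : TriMat M} (f : X ⟶ Y) (g : Y ⟶ Z) :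
    Hom.u (f ≫ g) = Hom.u f ≫ Hom.u g := rfl

@[ext] theorem hom_ext {X Y : TriMat M} {f g : X ⟶ Y} (ht : Hom.t f = Hom.t g)
    (hm : Hom.m f = Hom.m g) (hu : Hom.u f = Hom.u g) : f = g := Hom.ext ht hm hu

/-- The morphisms of the triangular matrix category, as triples of entries. -/
def homEquiv (X Y : TriMat M) :
    (X ⟶ Y) ≃ (X.fst ⟶ Y.fst) × M.at Y.snd X.fst × (X.snd ⟶ Y.snd) where
  toFun f := (Hom.t f, Hom.m f, Hom.u f)
  invFun z := Hom.mk z.1 z.2.1 z.2.2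
  left_inv _ := rfl
  right_inv _ := rfl

/-- Morphisms of the triangular matrix category are added entrywise. -/
instance : Preadditive (TriMat M) where
  homGroup X Y := (homEquiv X Y).addCommGroup
  add_comp X Y Z f f' g := by
    apply hom_ext
    · exact Preadditive.add_comp _ _ _ _ _ _
    · change M.ract (Hom.m g) (Hom.t f + Hom.t f') + M.lact (Hom.u g) (Hom.m f + Hom.m f') =
        (M.ract (Hom.m g) (Hom.t f) + M.lact (Hom.u g) (Hom.m f)) +
        (M.ract (Hom.m g) (Hom.t f') + M.lact (Hom.u g) (Hom.m f'))
      simp [Bimodule.ract, Bimodule.lact, Functor.map_add]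
      abel
    · exact Preadditive.add_comp _ _ _ _ _ _
  comp_add X Y Z f g g' := by
    apply hom_ext
    · exact Preadditive.comp_add _ _ _ _ _ _
    · change M.ract (Hom.m g + Hom.m g') (Hom.t f) + M.lact (Hom.u g + Hom.u g') (Hom.m f) =
        (M.ract (Hom.m g) (Hom.t f) + M.lact (Hom.u g) (Hom.m f)) +
        (M.ract (Hom.m g') (Hom.t f) + M.lact (Hom.u g') (Hom.m f))
      have h : M.lact (Hom.u g + Hom.u g') (Hom.m f) =
          M.lact (Hom.u g) (Hom.m f) + M.lact (Hom.u g') (Hom.m f) := by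
        simp only [Bimodule.lact, Functor.map_add]
        rfl
      rw [h]
      simp only [Bimodule.ract, map_add]
      abel
    · exact Preadditive.comp_add _ _ _ _ _ _

end TriMat

end TriangularMatrix

/-- The bimodule `Hom(T, U)` restricted to two full subcategories, `U ∈ P` (covariant) and
`T ∈ Q` (contravariant). -/
def homBimodule {C : Type u} [Category.{v} C] [Preadditive C] (P Q : ObjectProperty C) :
    Bimodule P.FullSubcategory Q.FullSubcategory where
  obj :=
    { obj := fun X => AdditiveFunctor.of (Q.ι.op ⋙ preadditiveYoneda.obj X.obj)
      map := fun f => ObjectProperty.homMk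
        (Functor.whiskerLeft Q.ι.op (preadditiveYoneda.map f.hom)) }
  property :=
    { map_add := fun {X Y f g} => by
        ext Z x
        exact Preadditive.comp_add _ _ _ _ _ _ }

end

end TriangularRecollement

open TriangularRecollement

/-!
The hypothesis that `C/I_B ⊗_C -` is exact enters through a single exact sequence. For an object `D`
with right `B`-approximation `f : X ⟶ D`, let `K` be the kernel of precomposition
`C(D, -) ⟶ C(X, -)` with `f`, so that `K(Z)` consists of the `g : D ⟶ Z` with `f ≫ g = 0`. As
`C/I_B ⊗_C C(X, -) = 0` for `X` in `B`, the map `C/I_B ⊗_C K ⟶ C/I_B ⊗_C C(D, -)` is surjective.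
Evaluating at `D`, where the target is `(C/I_B)(D, D)`, the identity of `D` is congruent modulo
`I_B` to some `k` with `f ≫ k = 0`; then `e = 𝟙 D - k` factors through `B` and satisfies `f ≫ e = f`
(`exists_factorsThrough_comp_eq`). Since `e` also factors through `f`, it is idempotent.

Splitting `e` writes `D` as a direct sum of `U`, a summand of an object of `B`, and a complement `T`
which receives no nonzero morphism from `B` (`exists_iso_biprod`). An indecomposable `D` must
therefore equal one of its two parts, which gives the splitting torsion pair. Moreover
`(T, U) ↦ T ⊞ U` is an essentially surjective functor from the triangular matrix category to `C`,
and it is fully faithful because the matrices of morphisms `T ⊞ U ⟶ T' ⊞ U'` have vanishing entry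
`U ⟶ T'`.
-/

namespace TriangularRecollement

attribute [local instance] hasBinaryBiproducts_of_finite_biproducts

/-! ### The kernel of precomposition and the tensor product with a representable module -/

section Representable

variable {C : Type u} [Category.{v} C] [Preadditive C]

/-- The representable module `C(A, -)`. -/
noncomputable def corepresentable (A : C) : ModCat C :=
  AdditiveFunctor.of (preadditiveCoyoneda.obj (op A))

/-- Precomposition `C(D, -) ⟶ C(X, -)` with `f : X ⟶ D`. -/
noncomputable def precomp {X D : C} (f : X ⟶ D) : corepresentable D ⟶ corepresentable X :=
  ObjectProperty.homMk (preadditiveCoyoneda.map f.op)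

/-- The kernel of precomposition with `f : X ⟶ D`, as a submodule of `C(D, -)`: its value at `Z`
is the group of all `g : D ⟶ Z` with `f ≫ g = 0`. -/
def precompKernel {X D : C} (f : X ⟶ D) : ModCat C where
  obj :=
    { obj := fun Z => AddCommGrpCat.of (Preadditive.leftComp Z f).ker
      map := fun {Z W} g => AddCommGrpCat.ofHom
        (((Preadditive.rightComp D g).comp (AddSubgroup.subtype _)).codRestrict _ fun x => by
          have hx : f ≫ x.1 = 0 := x.2
          change f ≫ x.1 ≫ g = 0
          rw [reassoc_of% hx, zero_comp])
      map_id := fun Z => by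
        ext x
        exact Category.comp_id x.1
      map_comp := fun g h => by
        ext x
        exact (Category.assoc x.1 g h).symm }
  property :=
    { map_add := fun {Z W g h} => by
        ext x
        exact Preadditive.comp_add _ _ _ x.1 g h }

/-- The inclusion of the kernel of precomposition. -/
noncomputable def precompKernelι {X D : C} (f : X ⟶ D) : precompKernel f ⟶ corepresentable D :=
  ObjectProperty.homMk
    { app := fun Z => AddCommGrpCat.ofHom (AddSubgroup.subtype (Preadditive.leftComp Z f).ker)
      naturality := fun _ _ _ => rfl }

theorem modExact_precompKernelι {X D : C} (f : X ⟶ D) :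
    ModExact (precompKernelι f) (precomp f) := fun Z (g : D ⟶ Z) =>
  ⟨fun h => ⟨⟨g, h⟩, rfl⟩, by rintro ⟨x, rfl⟩; exact x.2⟩

end Representable

theorem idealQuotientFunctor_map_eq_iff {C : Type u} [Category.{v} C] [Preadditive C]
    [HasFiniteBiproducts C] (P : ObjectProperty C) [IsAdditiveSubcategory P] {X Y : C}
    (f g : X ⟶ Y) :
    (idealQuotientFunctor P).map f = (idealQuotientFunctor P).map g ↔ FactorsThrough P (f - g) :=
  Quotient.functor_map_eq_iff (idealRel P) f g

section Tensor

variable {C : Type u} [Category.{v} C] [EssentiallySmall.{v} C]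

theorem tmul_balanced {N : Cᵒᵖ ⥤ AddCommGrpCat.{v}} {M : C ⥤ AddCommGrpCat.{v}}
    {c d : SmallModel.{v} C} (a : c ⟶ d) (x : N.obj (op ((smallEmb C).obj d)))
    (y : M.obj ((smallEmb C).obj c)) :
    tmul N M c (N.map ((smallEmb C).map a).op x) y = tmul N M d x (M.map ((smallEmb C).map a) y) :=
  sub_eq_zero.1 ((QuotientAddGroup.eq_zero_iff _).2
    (AddSubgroup.subset_closure (TensorRel.balanced (N := N) (M := M) a x y)))

theorem tmul_zero_left {N : Cᵒᵖ ⥤ AddCommGrpCat.{v}} {M : C ⥤ AddCommGrpCat.{v}} (c y) :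
    tmul N M c 0 y = 0 := by
  simpa using tmul_add_left (N := N) (M := M) c 0 0 y

/-- An object of the small model of `C` isomorphic to `A`. -/
noncomputable def smallEmbObjIso (A : C) :
    (smallEmb C).obj ((equivSmallModel.{v} C).functor.obj A) ≅ A :=
  ((equivSmallModel.{v} C).unitIso.app A).symm

variable [Preadditive C]

/-- Moving `y` across the tensor sign: `x ⊗ y` is the product of `x · y` and the identity of `A`,
up to the comparison of `A` with an object of the small model. -/
theorem tmul_corepresentable (N : Cᵒᵖ ⥤ AddCommGrpCat.{v}) {A : C} (c : SmallModel.{v} C)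
    (x : N.obj (op ((smallEmb C).obj c))) (y : A ⟶ (smallEmb C).obj c) :
    tmul N (corepresentable A).obj c x y = tmul N (corepresentable A).obj _
      (N.map (smallEmbObjIso A).hom.op (N.map y.op x)) (smallEmbObjIso A).inv := by
  obtain ⟨a, ha⟩ := (smallEmb C).map_surjective ((smallEmbObjIso A).hom ≫ y)
  have hy : (smallEmbObjIso A).inv ≫ (smallEmb C).map a = y := by
    rw [ha, Iso.inv_hom_id_assoc]
  have hx : N.map ((smallEmb C).map a).op x = N.map (smallEmbObjIso A).hom.op (N.map y.op x) := by
    rw [ha, op_comp, N.map_comp]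
    rfl
  rw [← hx]
  exact (congrArg (tmul N (corepresentable A).obj c x) hy).symm.trans (tmul_balanced a x _).symm

/-- `N ⊗_C C(A, -) = 0` as soon as `N(A) = 0`. -/
theorem tensor_corepresentable_eq_zero (N : Cᵒᵖ ⥤ AddCommGrpCat.{v}) (A : C)
    (hN : ∀ x : N.obj (op A), x = 0) (z : Tensor N (corepresentable A).obj) : z = 0 := by
  refine DFunLike.congr_fun (f := AddMonoidHom.id _) (g := 0) (tensor_hom_ext fun c x y => ?_) z
  refine (tmul_corepresentable N c x y).trans ?_
  rw [hN (N.map _ x), map_zero]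
  exact tmul_zero_left _ _

variable [HasFiniteBiproducts C] (P : ObjectProperty C) [IsAdditiveSubcategory P]

/-- The action `(C/I_B)(-, D) ⊗_C C(A, -) ⟶ (C/I_B)(A, D)`, `x ⊗ y ↦ x ∘ y`. -/
noncomputable def tensorEval (A : C) (D : IdealQuotient P) :
    Tensor ((quotientBimodule P).obj D) (corepresentable A).obj →+
      ((idealQuotientFunctor P).obj A ⟶ D) :=
  QuotientAddGroup.lift _
    (FreeAbelianGroup.lift fun z =>
      (idealQuotientFunctor P).map (show A ⟶ (smallEmb C).obj z.1 from z.2.2) ≫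
        (show (idealQuotientFunctor P).obj ((smallEmb C).obj z.1) ⟶ D from z.2.1)) (by
    refine (AddSubgroup.closure_le _).2 ?_
    rintro _ (⟨c, x, x', y⟩ | ⟨c, x, y, y'⟩ | ⟨a, x, y⟩)
    · simp only [tensorPure, SetLike.mem_coe, AddMonoidHom.mem_ker, map_sub, map_add,
        FreeAbelianGroup.lift_apply_of, sub_eq_zero]
      exact Preadditive.comp_add _ _ _ _ _ _
    · simp only [tensorPure, SetLike.mem_coe, AddMonoidHom.mem_ker, map_sub, map_add,
        FreeAbelianGroup.lift_apply_of, sub_eq_zero]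
      exact (congrArg (· ≫ _) ((idealQuotientFunctor P).map_add)).trans
        (Preadditive.add_comp _ _ _ _ _ _)
    · simp only [tensorPure, SetLike.mem_coe, AddMonoidHom.mem_ker, map_sub,
        FreeAbelianGroup.lift_apply_of, sub_eq_zero]
      exact (Category.assoc _ _ _).symm.trans
        (congrArg (· ≫ _) ((idealQuotientFunctor P).map_comp _ _).symm))

theorem tensorEval_tmul (A : C) (D : IdealQuotient P) (c : SmallModel.{v} C)
    (x : (idealQuotientFunctor P).obj ((smallEmb C).obj c) ⟶ D) (y : A ⟶ (smallEmb C).obj c) :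
    tensorEval P A D (tmul ((quotientBimodule P).obj D) (corepresentable A).obj c x y) =
      (idealQuotientFunctor P).map y ≫ x :=
  FreeAbelianGroup.lift_apply_of _ _

theorem exists_tensorEval_eq_id (D : C) :
    ∃ z, tensorEval P D ((idealQuotientFunctor P).obj D) z = 𝟙 _ := by
  refine ⟨tmul _ _ _ ((idealQuotientFunctor P).map (smallEmbObjIso D).hom) (smallEmbObjIso D).inv,
    (tensorEval_tmul P D _ _ _ _).trans ?_⟩
  rw [← Functor.map_comp, Iso.inv_hom_id, CategoryTheory.Functor.map_id]

/-- Tensors with the kernel of precomposition with `f` evaluate to classes of morphisms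
annihilated by `f`. -/
theorem exists_tensorEval_precompKernelι_eq {X D E : C} (f : X ⟶ D)
    (w : Tensor ((quotientBimodule P).obj ((idealQuotientFunctor P).obj E)) (precompKernel f).obj) :
    ∃ k : D ⟶ E, f ≫ k = 0 ∧
      tensorEval P D _ (tensorMap (𝟙 _) (precompKernelι f).hom w) =
        (idealQuotientFunctor P).map k := by
  obtain ⟨w, rfl⟩ := QuotientAddGroup.mk_surjective w
  induction w using FreeAbelianGroup.induction_on with
  | zero => exact ⟨0, by simp, by simp⟩
  | of z =>
    obtain ⟨c, x, y⟩ := z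
    obtain ⟨x', hx'⟩ := (idealQuotientFunctor P).map_surjective x
    have hy : f ≫ y.1 = 0 := y.2
    refine ⟨y.1 ≫ x', by rw [reassoc_of% hy, zero_comp], ?_⟩
    refine (tensorEval_tmul P D _ c x y.1).trans ?_
    rw [Functor.map_comp, hx']
  | neg z ih =>
    obtain ⟨k, hk, h⟩ := ih
    refine ⟨-k, by simp [hk], ?_⟩
    rw [QuotientAddGroup.mk_neg, map_neg, map_neg, h, Functor.map_neg]
  | add a b iha ihb =>
    obtain ⟨k, hk, h⟩ := iha
    obtain ⟨l, hl, h'⟩ := ihb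
    refine ⟨k + l, by simp [hk, hl], ?_⟩
    rw [QuotientAddGroup.mk_add, map_add, map_add, h, h', Functor.map_add]

variable {P}

/-- If `C/I_B ⊗_C -` is exact, then every morphism `f` from an object of `B` to `D` is fixed by an
endomorphism of `D` in the ideal `I_B`. -/
theorem exists_factorsThrough_comp_eq (hexact : IsExactFunctor (quotientTensor P)) {X D : C}
    (hX : P X) (f : X ⟶ D) : ∃ e : D ⟶ D, FactorsThrough P e ∧ f ≫ e = f := by
  obtain ⟨z, hz⟩ := exists_tensorEval_eq_id P D
  have hN : ∀ x : (((quotientBimodule P).obj ((idealQuotientFunctor P).obj D)).obj (op X)),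
      x = 0 := fun x => by
    obtain ⟨x', rfl⟩ := (idealQuotientFunctor P).map_surjective x
    refine Eq.trans ?_ ((idealQuotientFunctor P).map_zero X D)
    exact (idealQuotientFunctor_map_eq_iff P _ _).2 ⟨X, 𝟙 X, x', hX, by simp⟩
  obtain ⟨w, hw⟩ := (hexact _ _ (modExact_precompKernelι f) ((idealQuotientFunctor P).obj D) z).1
    (tensor_corepresentable_eq_zero _ X hN _)
  obtain ⟨k, hk, h⟩ := exists_tensorEval_precompKernelι_eq P f w
  refine ⟨𝟙 D - k, (idealQuotientFunctor_map_eq_iff P _ _).1 ?_, by simp [hk]⟩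
  rw [← h, CategoryTheory.Functor.map_id, ← hz]
  exact congrArg (tensorEval P D _) hw.symm

end Tensor

/-! ### Direct sum decompositions -/

section Decomposition

variable {C : Type u} [Category.{v} C] [Preadditive C]

/-- With split idempotents, a retract is a direct summand: `j` and `q` are the inclusion of, and
the projection to, a complement. -/
theorem exists_complement [IsIdempotentComplete C] {X Y : C} (i : Y ⟶ X) (p : X ⟶ Y)
    (hip : i ≫ p = 𝟙 Y) : ∃ (Z : C) (j : Z ⟶ X) (q : X ⟶ Z), j ≫ q = 𝟙 Z ∧ i ≫ q = 0 ∧ j ≫ p = 0 ∧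
      p ≫ i + q ≫ j = 𝟙 X := by
  obtain ⟨Z, j, q, hjq, hqj⟩ := IsIdempotentComplete.idempotents_split X (𝟙 X - p ≫ i)
    (by simp [reassoc_of% hip])
  refine ⟨Z, j, q, hjq, ?_, ?_, by rw [hqj]; abel⟩
  · have : i ≫ q ≫ j ≫ q = 0 := by rw [reassoc_of% hqj]; simp [reassoc_of% hip]
    simpa [hjq] using this
  · have : (j ≫ q) ≫ j ≫ p = 0 := by rw [Category.assoc, reassoc_of% hqj]; simp [hip]
    simpa [hjq] using this

variable [HasFiniteBiproducts C]

/-- The isomorphism `X ≅ Y ⊞ Z` given by complementary inclusions and projections. -/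
noncomputable def isoBiprod {X Y Z : C} (i : Y ⟶ X) (p : X ⟶ Y) (j : Z ⟶ X) (q : X ⟶ Z)
    (hip : i ≫ p = 𝟙 Y) (hjq : j ≫ q = 𝟙 Z) (hiq : i ≫ q = 0) (hjp : j ≫ p = 0)
    (h : p ≫ i + q ≫ j = 𝟙 X) : X ≅ Y ⊞ Z where
  hom := biprod.lift p q
  inv := biprod.desc i j
  hom_inv_id := by simpa using h
  inv_hom_id := by ext <;> simp [hip, hjq, hiq, hjp]

theorem isAdditiveSubcategory_rightOrthogonal (P : ObjectProperty C) :
    IsAdditiveSubcategory P.rightOrthogonal where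
  of_isZero _ hX _ _ _ := hX.eq_of_tgt _ _
  biprod X Y hX hY W w hW := by
    ext
    · simpa using hX (w ≫ biprod.fst) hW
    · simpa using hY (w ≫ biprod.snd) hW
  of_iso X Y e hX W w hW := by
    rw [← cancel_mono e.inv, zero_comp]
    exact hX (w ≫ e.inv) hW

variable [IsIdempotentComplete C] {P : ObjectProperty C}

theorem prop_of_retract (hP : addClosure P = P) {X Y : C} (hX : P X) (i : Y ⟶ X) (p : X ⟶ Y)
    (hip : i ≫ p = 𝟙 Y) : P Y := by
  obtain ⟨Z, j, q, hjq, hiq, hjp, h⟩ := exists_complement i p hip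
  rw [← hP]
  exact ⟨1, fun _ => X, Z, fun _ => hX,
    ⟨(isoBiprod i p j q hip hjq hiq hjp h).symm ≪≫ (biproductUniqueIso fun _ : Fin 1 => X).symm⟩⟩

/-- Every object is a direct sum of an object of `B` and an object of its right orthogonal. -/
theorem exists_iso_biprod [EssentiallySmall.{v} C] [IsAdditiveSubcategory P]
    (hP : addClosure P = P) (hexact : IsExactFunctor (quotientTensor P))
    (hfin : IsContravariantlyFinite P) (D : C) :
    ∃ T U : C, P.rightOrthogonal T ∧ P U ∧ Nonempty (D ≅ T ⊞ U) := by
  obtain ⟨X, f, hX, hf⟩ := hfin D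
  obtain ⟨e, ⟨X', a, b, hX', hab⟩, hfe⟩ := exists_factorsThrough_comp_eq hexact hX f
  have he : e ≫ e = e := by
    obtain ⟨g, rfl⟩ := hf X' b hX'
    rw [← hab, Category.assoc, Category.assoc, hab, hfe, hab]
  obtain ⟨U, i, p, hip, hpi⟩ := IsIdempotentComplete.idempotents_split D e he
  obtain ⟨T, j, q, hjq, hiq, hjp, h⟩ := exists_complement i p hip
  refine ⟨T, U, fun W w hW => ?_, prop_of_retract hP hX' (i ≫ a) (b ≫ p) ?_,
    ⟨isoBiprod j q i p hjq hip hjp hiq ((add_comm _ _).trans h)⟩⟩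
  · obtain ⟨g, hg⟩ := hf W (w ≫ j) hW
    have hfq : f ≫ q = 0 := by rw [← hfe, ← hpi]; simp [hiq]
    calc w = (w ≫ j) ≫ q := by simp [hjq]
      _ = 0 := by rw [← hg, Category.assoc, hfq, comp_zero]
  · calc (i ≫ a) ≫ b ≫ p = i ≫ (a ≫ b) ≫ p := by simp
      _ = (i ≫ p) ≫ i ≫ p := by rw [hab, ← hpi]; simp
      _ = 𝟙 U := by simp [hip]

end Decomposition

/-! ### The functor from the triangular matrix category -/

section TriMat

variable {C : Type u} [Category.{v} C] [Preadditive C] [HasFiniteBiproducts C]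

/-- The morphism `T ⊞ U ⟶ T' ⊞ U'` with matrix `[[t, 0], [m, u]]`. -/
noncomputable def lowerTriangular {T U T' U' : C} (t : T ⟶ T') (m : T ⟶ U') (u : U ⟶ U') :
    T ⊞ U ⟶ T' ⊞ U' :=
  biprod.desc (biprod.lift t m) (u ≫ biprod.inr)

theorem lowerTriangular_id (T U : C) : lowerTriangular (𝟙 T) 0 (𝟙 U) = 𝟙 (T ⊞ U) := by
  ext <;> simp [lowerTriangular]

theorem lowerTriangular_comp {T U T' U' T'' U'' : C} (t : T ⟶ T') (m : T ⟶ U') (u : U ⟶ U')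
    (t' : T' ⟶ T'') (m' : T' ⟶ U'') (u' : U' ⟶ U'') :
    lowerTriangular t m u ≫ lowerTriangular t' m' u' =
      lowerTriangular (t ≫ t') (t ≫ m' + m ≫ u') (u ≫ u') := by
  ext <;> simp [lowerTriangular, biprod.lift_desc]

theorem lowerTriangular_add {T U T' U' : C} (t t' : T ⟶ T') (m m' : T ⟶ U') (u u' : U ⟶ U') :
    lowerTriangular (t + t') (m + m') (u + u') =
      lowerTriangular t m u + lowerTriangular t' m' u' := by
  ext <;> simp [lowerTriangular]

theorem lowerTriangular_inj {T U T' U' : C} {t t' : T ⟶ T'} {m m' : T ⟶ U'} {u u' : U ⟶ U'}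
    (h : lowerTriangular t m u = lowerTriangular t' m' u') : t = t' ∧ m = m' ∧ u = u' := by
  refine ⟨?_, ?_, ?_⟩
  · simpa [lowerTriangular] using congr(biprod.inl ≫ $h ≫ biprod.fst)
  · simpa [lowerTriangular] using congr(biprod.inl ≫ $h ≫ biprod.snd)
  · simpa [lowerTriangular] using congr(biprod.inr ≫ $h ≫ biprod.snd)

theorem lowerTriangular_eq {T U T' U' : C} (f : T ⊞ U ⟶ T' ⊞ U')
    (hf : biprod.inr ≫ f ≫ biprod.fst = 0) :
    lowerTriangular (biprod.inl ≫ f ≫ biprod.fst) (biprod.inl ≫ f ≫ biprod.snd)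
      (biprod.inr ≫ f ≫ biprod.snd) = f := by
  ext <;> simp [lowerTriangular, hf]

variable (P Q : ObjectProperty C)

/-- The functor `(T, U) ↦ T ⊞ U` from the triangular matrix category of `Hom(T, U)`, sending a
triangular matrix to the morphism with this matrix. -/
noncomputable def triMatBiprod : TriMat (homBimodule P Q) ⥤ C where
  obj X := X.fst.obj ⊞ X.snd.obj
  map φ := lowerTriangular (TriMat.Hom.t φ).hom (TriMat.Hom.m φ) (TriMat.Hom.u φ).hom
  map_id _ := lowerTriangular_id _ _
  map_comp _ _ := (lowerTriangular_comp _ _ _ _ _ _).symm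

instance : (triMatBiprod P Q).Additive where
  map_add := lowerTriangular_add _ _ _ _ _ _

instance : (triMatBiprod P Q).Faithful where
  map_injective h := by
    obtain ⟨ht, hm, hu⟩ := lowerTriangular_inj h
    exact TriMat.hom_ext (InducedCategory.hom_ext ht) hm (InducedCategory.hom_ext hu)

/-- Fullness is where `Hom(U, T) = 0` is needed: all matrices are lower triangular. -/
instance : (triMatBiprod P P.rightOrthogonal).Full where
  map_surjective {X Y} f :=
    ⟨TriMat.Hom.mk ⟨biprod.inl ≫ f ≫ biprod.fst⟩ (biprod.inl ≫ f ≫ biprod.snd :)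
      ⟨biprod.inr ≫ f ≫ biprod.snd⟩, lowerTriangular_eq f (Y.fst.property _ X.snd.property)⟩

end TriMat

end TriangularRecollement

theorem theorem5p4 {C : Type u} [Category.{v} C] [EssentiallySmall.{v} C] [Preadditive C]
    [HasFiniteBiproducts C] [IsIdempotentComplete C] (hC : IsKrullSchmidt C)
    (B : ObjectProperty C) [IsAdditiveSubcategory B] (hB : addClosure B = B)
    (hexact : IsExactFunctor (quotientTensor B)) (hfin : IsContravariantlyFinite B) :
    IsSplittingTorsionPair B B.rightOrthogonal ∧
      ∃ Ξ : C ≌ TriMat (homBimodule B B.rightOrthogonal), Ξ.functor.Additive := by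
  have hdec := exists_iso_biprod hB hexact hfin
  have hadd := isAdditiveSubcategory_rightOrthogonal B
  refine ⟨⟨inferInstance, hadd, fun X hX => ?_, fun X Y f hX hY => hY f hX⟩, ?_⟩
  · obtain ⟨T, U, hT, hU, ⟨φ⟩⟩ := hdec X
    rcases hX.2 T U φ with h | h
    · exact .inl (IsAdditiveSubcategory.of_iso _ _ φ.symm
        (IsAdditiveSubcategory.biprod _ _ (IsAdditiveSubcategory.of_isZero _ h) hU))
    · exact .inr (hadd.of_iso _ _ φ.symm (hadd.biprod _ _ hT (hadd.of_isZero _ h)))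
  · have : (triMatBiprod B B.rightOrthogonal).EssSurj := ⟨fun X => by
      obtain ⟨T, U, hT, hU, ⟨φ⟩⟩ := hdec X
      exact ⟨⟨⟨T, hT⟩, ⟨U, hU⟩⟩, ⟨φ.symm⟩⟩⟩
    have : (triMatBiprod B B.rightOrthogonal).IsEquivalence := {}
    let Φ := (triMatBiprod B B.rightOrthogonal).asEquivalence
    have : Φ.functor.Additive := inferInstanceAs (triMatBiprod B B.rightOrthogonal).Additive
    exact ⟨Φ.symm, Φ.inverse_additive⟩
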